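/- **Setting.** Let $\mu$ be a probability density on $\mathbb R^p$ and write $\langle g,\nu\rangle=\int g\,\nu\,dx$ for a density $\nu$. Let $f^{(1)},\dots,f^{(K+1)}:\mathbb R^p\to\mathbb R^q$ be measurable models ($f^{(K+1)}$ is the high-fidelity one) with error bounds $\|f^{(K+1)}(x)-f^{(k)}(x)\|_2\le\epsilon_k(x)$, $\epsilon_{K+1}=0$, and let $h:\mathbb R^q\to\mathbb R$ be $c$-Lipschitz (for example linear with $c=\|h\|$, or the sup norm with $c=1$). Put $\phi^{(k)}=h\circ f^{(k)}$, $\phi=\phi^{(K+1)}$ and $A=\{x:\phi(x)\ge\gamma^\star\}$. Let $\mathcal V=\{\nu^\theta:\theta\in\Theta\}$, $\emptyset\ne\Theta\subset\mathbb R^d$, be a family of probability densities on $\mathbb R^p$, and let $\nu_0$ be a probability density that is positive wherever $\mu$ is. For a (possibly empirical) distribution $\nu$ put $\gamma(\nu,\rho,\psi)=\max\{s:\langle 1_{\psi<s},\nu\rangle\le1-\rho\}$. For samples $z_1,\dots,z_m$ with empirical distribution $\hat\nu$ put $\alpha_k(\hat\nu)=c\max_{i\le m}\epsilon_k(z_i)$.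 **Assumption B.** (i) $\Theta$ is compact; (ii) for $\mu$-almost every $x$, $\theta\mapsto\ln\nu^\theta(x)$ is continuous on $\Theta$; (iii) there is a real function $H$ on $\mathbb R^p$ with $\langle H,\mu\rangle<\infty$ and $|\ln\nu^\theta(x)|\le H(x)$ for all $x$ and $\theta$ (in particular $\nu^\theta>0$). **Algorithm.** Parameters: $m_0\ge1$, $\rho_0\in(0,1)$, $\delta>0$, $\beta>1$. Start with $j=0$, $k_0=1$ and $m_0$ i.i.d. samples from $\nu_0$. Abbreviate $\hat\gamma_j=\gamma(\hat\nu_j,\rho_j,\phi^{(k_j)})$ and $\hat\alpha_j=\alpha_{k_j}(\hat\nu_j)$. While $\hat\gamma_j<\gamma^\star+\hat\alpha_j$: replace $j$ by $j+1$; choose $$\nu_j\in\operatorname*{argmax}_{\nu^\theta\in\mathcal V}\frac1{m_{j-1}}\sum_{i=1}^{m_{j-1}}1_{\hat A_j}(z_i)\frac{\mu(z_i)}{\nu_{j-1}(z_i)}\ln\nu^\theta(z_i),\qquad(*)$$ where $\hat A_j=\{\phi^{(k_{j-1})}\ge\min(\hat\gamma_{j-1}-2\hat\alpha_{j-1},\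 \gamma^\star+\hat\alpha_{j-1})\}$ and the $z_i$ are the samples from $\nu_{j-1}$; draw at least $m_{j-1}$ i.i.d. samples from $\nu_j$; and, starting from $\rho_{j-1}$, $k_{j-1}$ and the number of samples drawn, adapt $(m_j,\rho_j,k_j)$ until $$\hat\gamma_j\ge\bar\gamma:=\min\{\gamma^\star+\hat\alpha_j,\ \hat\gamma_{j-1}+2\hat\alpha_{j-1}+\delta\}\quad\text{and}\quad\hat\alpha_j\le\hat\alpha_{j-1}.$$ The adaptation repeats the following while these two conditions do not both hold. With $k=k_j$, $\alpha=\alpha_k(\hat\nu_j)$, $\underline\rho=\langle1_{\phi^{(k)}\ge\bar\gamma+\alpha},\hat\nu_j\rangle$ and $\bar\rho=\langle1_{\phi^{(k)}\ge\bar\gamma-\alpha},\hat\nu_j\rangle$, let $$\varpi=\underline\rho-\max\big\{\langle1_{\phi^{(k)}\in[t,t+\alpha]},\hat\nu_j\rangle:\ \gamma(\hat\nu_j,\bar\rho,\phi^{(k)})\le t\le\gamma(\hat\nu_j,\underline\rho,\phi^{(k)})\big\}.$$ If $k\le K$ and $\varpi\le0$, increase $k_j$ by one; if $k\le K$ and the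 second condition fails, $k_j$ may also be increased by one. If $k=K+1$ or $\varpi>0$, adapt $(m_j,\rho_j)$ at fixed $k_j$: while the first condition fails, set $\rho_j$ to the largest $\rho\in(0,1)$ with $\gamma(\hat\nu_j,\rho,\phi^{(k_j)})\ge\bar\gamma$ if there is one, and otherwise draw further i.i.d. samples from $\nu_j$ so that their number becomes $\lceil\beta m_j\rceil$. When the main loop ends, put $J=j+1$ and return a solution $\hat\nu_A^{\theta^\star}=\nu_J=\nu^{\hat\theta}$ of $(*)$ for $j=J$ with $\hat A_J$ replaced by $A$. **Proposition.** Suppose that Assumption B holds, and consider executions of the algorithm whose proposals and quantile parameters satisfy the quantile-increase condition $$\gamma(\nu_j,\rho_j,\phi)\ge\min\{\gamma^\star,\ \gamma(\nu_{j-1},\rho_{j-1},\phi)+\delta\}\qquad(1\le j\le J-1).$$ 1. The number of iterations satisfies $$J\le\hat J_{\max}=\Big\lceil\frac{\gamma^\star-\gamma(\hat\nu_0,\rho_0,\phi)}{\delta}\Big\rceil+1$$ if $\gamma(\hat\nu_0,\rho_0,\phi)<\gamma^\star$, and $J\le2$ otherwise. (The main loop cannot be entered more often than this, whatever the samples.)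 2. The set $\Theta^\star=\operatorname*{argmax}_{\theta\in\Theta}\langle1_A\ln\nu^\theta,\mu\rangle$ is non-empty and, given the last sampling density $\nu_{J-1}$ (equal to $\nu_0$ or to any element of $\mathcal V$, whatever the earlier stages), for almost every sequence $z_1,z_2,\dots$ of i.i.d. samples from $\nu_{J-1}$, the problem that defines the output has a solution for every $m_{J-1}$, and, as $m_{J-1}\to\infty$, every choice of the output parameters $\hat\theta$ satisfies $$\operatorname{dist}(\hat\theta,\Theta^\star)\to0\quad\text{and}\quad\inf_{\theta\in\Theta^\star}|\nu^{\hat\theta}(x)-\nu^{\theta}(x)|\to0\ \text{ for $\mu$-almost every }x.$$ In particular, if the optimal density $\nu_A^{\theta^\star}$, $\theta^\star\in\Theta^\star$, is unique, the returned biasing density converges to it $\mu$-almost everywhere, almost surely. -/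

import Mathlib

open MeasureTheory ProbabilityTheory Filter Topology

namespace CrossEntropy

/-- The space `ℝⁿ` with its Euclidean norm. -/
abbrev Vec (n : ℕ) := EuclideanSpace ℝ (Fin n)

/-- `g` is a probability density on `ℝᵖ` with respect to Lebesgue measure. -/
structure IsDensity {p : ℕ} (g : Vec p → ℝ) : Prop where
  measurable : Measurable g
  nonneg : ∀ x, 0 ≤ g x
  lintegral_eq_one : ∫⁻ x, ENNReal.ofReal (g x) = 1

/-- The distribution on `ℝᵖ` with density `g`. -/
noncomputable def law {p : ℕ} (g : Vec p → ℝ) : Measure (Vec p) :=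
  volume.withDensity fun x => ENNReal.ofReal (g x)

/-- The set of maximisers of `F` over `S`. -/
def argmaxOn {X : Type*} (F : X → ℝ) (S : Set X) : Set X :=
  {x | x ∈ S ∧ ∀ y ∈ S, F y ≤ F x}

/-- The indicator function of `S`, with real values. -/
noncomputable def ind {X : Type*} (S : Set X) : X → ℝ := S.indicator fun _ => 1

/-- The expectation of `g` under the empirical distribution of the first `m` samples of `z`. -/
noncomputable def empMean {X : Type*} (z : ℕ → X) (m : ℕ) (g : X → ℝ) : ℝ :=
  (∑ i ∈ Finset.range m, g (z i)) / m

/-- The `(1 - ρ)`-quantile `max {s | ⟨1_{ψ < s}⟩ ≤ 1 - ρ}` of `ψ` under the expectation functional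
`expect` (a distribution or an empirical distribution). For `0 < ρ < 1` the maximum exists. -/
noncomputable def quantile {X : Type*} (expect : (X → ℝ) → ℝ) (ρ : ℝ) (ψ : X → ℝ) : ℝ :=
  sSup {s : ℝ | expect (ind {x | ψ x < s}) ≤ 1 - ρ}

/-- Quantile under the empirical distribution of the first `m` samples of `z`. -/
noncomputable def empQuantile {X : Type*} (z : ℕ → X) (m : ℕ) (ρ : ℝ) (ψ : X → ℝ) : ℝ :=
  quantile (empMean z m) ρ ψ

/-- Quantile under the distribution with density `g`. -/
noncomputable def popQuantile {p : ℕ} (g : Vec p → ℝ) (ρ : ℝ) (ψ : Vec p → ℝ) : ℝ :=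
  quantile (fun f => ∫ x, f x ∂(law g)) ρ ψ

/-- The data of the rare event problem and the input parameters of the algorithm.
The hierarchy has `K + 1` models; level `0` is the coarsest and `Fin.last K` is the
high-fidelity model. -/
structure Problem (p q d K : ℕ) where
  /-- density of the random element `X` -/
  μ : Vec p → ℝ
  μ_density : IsDensity μ
  /-- the models `f⁽ᵏ⁾` -/
  model : Fin (K + 1) → Vec p → Vec q
  model_measurable : ∀ k, Measurable (model k)
  /-- the function `h` that turns the output of a model into a score -/
  h : Vec q → ℝ
  /-- Lipschitz constant of `h`: the operator norm of a linear `h`, or `1` for the sup norm -/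
  c : ℝ
  c_nonneg : 0 ≤ c
  h_lipschitz : ∀ u v, |h u - h v| ≤ c * ‖u - v‖
  /-- the error bounds `ε_k` of the models -/
  err : Fin (K + 1) → Vec p → ℝ
  err_bound : ∀ k x, ‖model (Fin.last K) x - model k x‖ ≤ err k x
  err_last : ∀ x, err (Fin.last K) x = 0
  /-- the score that defines the rare event -/
  γstar : ℝ
  /-- the parameter set and the parametrised densities `ν^θ` -/
  Θ : Set (Vec d)
  Θ_nonempty : Θ.Nonempty
  ν : Vec d → Vec p → ℝ
  ν_density : ∀ θ ∈ Θ, IsDensity (ν θ)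
  /-- initial proposal, whose support contains that of `μ` -/
  ν₀ : Vec p → ℝ
  ν₀_density : IsDensity ν₀
  ν₀_support : ∀ x, 0 < μ x → 0 < ν₀ x
  /-- initial quantile parameter -/
  ρ₀ : ℝ
  ρ₀_pos : 0 < ρ₀
  ρ₀_lt_one : ρ₀ < 1
  /-- minimal quantile increase -/
  δ : ℝ
  δ_pos : 0 < δ
  /-- growth factor of the sample size -/
  β : ℝ
  one_lt_β : 1 < β

/-- The state of the algorithm at the end of one iteration: the proposal density `ν_j`, the stream
`z` of samples that are drawn from it, the number `m_j` of samples used, the quantile parameter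
`ρ_j` and the approximation level `k_j`. -/
structure Stage (p K : ℕ) where
  ν : Vec p → ℝ
  z : ℕ → Vec p
  m : ℕ
  ρ : ℝ
  k : Fin (K + 1)

namespace Problem

variable {p q d K : ℕ} (P : Problem p q d K)

/-- The score function approximation `φ⁽ᵏ⁾`. -/
def score (k : Fin (K + 1)) (x : Vec p) : ℝ := P.h (P.model k x)

/-- The original score function `φ`. -/
def φ (x : Vec p) : ℝ := P.score (Fin.last K) x

/-- The rare event `A`. -/
def A : Set (Vec p) := {x | P.γstar ≤ P.φ x}

/-- Compactness of the parameter set, almost everywhere continuity of `θ ↦ ln ν^θ(x)`, and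
integrable domination. The bound on `|ln ν^θ(x)|` by a real number contains `ν^θ(x) > 0`. -/
structure AssumptionB : Prop where
  compact : IsCompact P.Θ
  continuous : ∀ᵐ x ∂(law P.μ), ContinuousOn (fun θ => Real.log (P.ν θ x)) P.Θ
  dominated : ∃ H : Vec p → ℝ, Integrable H (law P.μ) ∧
    ∀ θ ∈ P.Θ, ∀ x, 0 < P.ν θ x ∧ |Real.log (P.ν θ x)| ≤ H x

/-- The parameters of the optimal cross-entropy densities, `argmax ⟨1_A ln ν^θ, μ⟩`. -/
noncomputable def optimal : Set (Vec d) :=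
  argmaxOn (fun θ => ∫ x, ind P.A x * Real.log (P.ν θ x) ∂(law P.μ)) P.Θ

/-- The empirical error bound `α_k` computed with the first `m` samples of `z`. -/
noncomputable def errBound (z : ℕ → Vec p) (m : ℕ) (k : Fin (K + 1)) : ℝ :=
  P.c * ⨆ i : Fin m, P.err k (z i)

/-- The empirical quantile `γ(ν̂_j, ρ_j, φ⁽ᵏ⁾)` with `k = k_j`. -/
noncomputable def γhat (s : Stage p K) : ℝ := empQuantile s.z s.m s.ρ (P.score s.k)

/-- The empirical error bound `α_k(ν̂_j)` with `k = k_j`. -/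
noncomputable def αhat (s : Stage p K) : ℝ := P.errBound s.z s.m s.k

/-- The relaxed event used to compute the next proposal. -/
noncomputable def relaxedSet (s : Stage p K) : Set (Vec p) :=
  {x | min (P.γhat s - 2 * P.αhat s) (P.γstar + P.αhat s) ≤ P.score s.k x}

/-- The Monte Carlo cross-entropy objective
`(1/m) ∑ 1_C(z_i) (μ(z_i) / g(z_i)) ln ν^θ(z_i)`, for samples `z_i` from the density `g`. -/
noncomputable def objective (g : Vec p → ℝ) (z : ℕ → Vec p) (m : ℕ) (C : Set (Vec p))
    (θ : Vec d) : ℝ :=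
  empMean z m fun x => ind C x * (P.μ x / g x) * Real.log (P.ν θ x)

/-- The exit condition of the main loop. -/
def Stopped (s : Stage p K) : Prop := P.γstar + P.αhat s ≤ P.γhat s

/-- The target `γ̄ = min {γ⋆ + α_k(ν̂_j), γ̃}` for the quantile, where
`γ̃ = γ(ν̂_{j-1}, ρ_{j-1}, φ⁽ᵏ'⁾) + 2 α_k'(ν̂_{j-1}) + δ` is computed from the previous stage. -/
noncomputable def γbar (prev : Stage p K) (z : ℕ → Vec p) (m : ℕ) (k : Fin (K + 1)) : ℝ :=
  min (P.γstar + P.errBound z m k) (P.γhat prev + 2 * P.αhat prev + P.δ)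

/-- The quantile condition of the adaptation step. -/
def QuantileOK (prev : Stage p K) (z : ℕ → Vec p) (m : ℕ) (ρ : ℝ) (k : Fin (K + 1)) : Prop :=
  P.γbar prev z m k ≤ empQuantile z m ρ (P.score k)

/-- The error condition of the adaptation step. -/
def ErrorOK (prev : Stage p K) (z : ℕ → Vec p) (m : ℕ) (k : Fin (K + 1)) : Prop :=
  P.errBound z m k ≤ P.αhat prev

/-- The estimate `⟨1_{φ⁽ᵏ⁾ ≥ t}, ν̂_j⟩`. -/
noncomputable def tail (z : ℕ → Vec p) (m : ℕ) (k : Fin (K + 1)) (t : ℝ) : ℝ :=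
  empMean z m (ind {x | t ≤ P.score k x})

/-- The estimator `η̄`: the maximum of `⟨1_{φ⁽ᵏ⁾ ∈ [t, t + α]}, ν̂_j⟩` over `t` between the quantiles
of orders given by the upper and by the lower tail estimate at `γ̄`. -/
noncomputable def ηbar (prev : Stage p K) (z : ℕ → Vec p) (m : ℕ) (k : Fin (K + 1)) : ℝ :=
  sSup ((fun t => empMean z m (ind {x | P.score k x ∈ Set.Icc t (t + P.errBound z m k)})) ''
    Set.Icc
      (empQuantile z m (P.tail z m k (P.γbar prev z m k - P.errBound z m k)) (P.score k))
      (empQuantile z m (P.tail z m k (P.γbar prev z m k + P.errBound z m k)) (P.score k)))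

/-- The criterion `ϖ` for keeping the approximation level. -/
noncomputable def criterion (prev : Stage p K) (z : ℕ → Vec p) (m : ℕ) (k : Fin (K + 1)) : ℝ :=
  P.tail z m k (P.γbar prev z m k + P.errBound z m k) - P.ηbar prev z m k

/-- Adaptation of the sample size and of the quantile parameter at a fixed level `k`:
`AdaptSize prev z k m ρ m' ρ'` means that the loop, entered with `(m, ρ)`, ends with `(m', ρ')`.
Additional samples are taken from the same stream `z`. -/
inductive AdaptSize (prev : Stage p K) (z : ℕ → Vec p) (k : Fin (K + 1)) :
    ℕ → ℝ → ℕ → ℝ → Prop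
  | done {m : ℕ} {ρ : ℝ} (hq : P.QuantileOK prev z m ρ k) : AdaptSize prev z k m ρ m ρ
  | lower {m m' : ℕ} {ρ r ρ' : ℝ} (hq : ¬ P.QuantileOK prev z m ρ k)
      (hr : IsGreatest {r : ℝ | 0 < r ∧ r < 1 ∧ P.QuantileOK prev z m r k} r)
      (next : AdaptSize prev z k m r m' ρ') : AdaptSize prev z k m ρ m' ρ'
  | enlarge {m m' : ℕ} {ρ ρ' : ℝ} (hq : ¬ P.QuantileOK prev z m ρ k)
      (hr : ¬ ∃ r : ℝ, 0 < r ∧ r < 1 ∧ P.QuantileOK prev z m r k)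
      (next : AdaptSize prev z k ⌈P.β * m⌉₊ ρ m' ρ') : AdaptSize prev z k m ρ m' ρ'

/-- Adaptation of the sample size and of the quantile parameter with selection of the level:
`Adapt prev z m ρ k m' ρ' k'` means that the loop, entered with `(m, ρ, k)`, can end with
`(m', ρ', k')`. The level is refined if the criterion is not positive, and it may also be refined
if the error condition fails. -/
inductive Adapt (prev : Stage p K) (z : ℕ → Vec p) :
    ℕ → ℝ → Fin (K + 1) → ℕ → ℝ → Fin (K + 1) → Prop
  | done {m : ℕ} {ρ : ℝ} {k : Fin (K + 1)}
      (hok : P.QuantileOK prev z m ρ k ∧ P.ErrorOK prev z m k) : Adapt prev z m ρ k m ρ k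
  | top {m m₁ m' : ℕ} {ρ ρ₁ ρ' : ℝ} {k k' : Fin (K + 1)}
      (hok : ¬ (P.QuantileOK prev z m ρ k ∧ P.ErrorOK prev z m k))
      (hk : k = Fin.last K) (hsize : P.AdaptSize prev z k m ρ m₁ ρ₁)
      (next : Adapt prev z m₁ ρ₁ k m' ρ' k') : Adapt prev z m ρ k m' ρ' k'
  | keep {m m₁ m' : ℕ} {ρ ρ₁ ρ' : ℝ} {k k' : Fin (K + 1)}
      (hok : ¬ (P.QuantileOK prev z m ρ k ∧ P.ErrorOK prev z m k))
      (hk : k ≠ Fin.last K) (hcrit : 0 < P.criterion prev z m k)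
      (hsize : P.AdaptSize prev z k m ρ m₁ ρ₁)
      (next : Adapt prev z m₁ ρ₁ k m' ρ' k') : Adapt prev z m ρ k m' ρ' k'
  | refine {m m' : ℕ} {ρ ρ' : ℝ} {k k₁ k' : Fin (K + 1)}
      (hok : ¬ (P.QuantileOK prev z m ρ k ∧ P.ErrorOK prev z m k))
      (hk : k₁.val = k.val + 1)
      (hcrit : P.criterion prev z m k ≤ 0 ∨ ¬ P.ErrorOK prev z m k)
      (next : Adapt prev z m ρ k₁ m' ρ' k') : Adapt prev z m ρ k m' ρ' k'

/-- One iteration of the main loop. The proposal is a solution of the Monte Carlo cross-entropy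
problem of the previous stage; at least as many samples as before (`N ≥ m_{j-1}`) are drawn from
it, and `(m_j, ρ_j, k_j)` is adapted. The choice of `N` is left free so that every sample size can
be sent to infinity; the smallest choice is `N = m_{j-1}`. -/
def Iteration (prev s : Stage p K) : Prop :=
  (∃ θ ∈ argmaxOn (P.objective prev.ν prev.z prev.m (P.relaxedSet prev)) P.Θ, s.ν = P.ν θ) ∧
    ∃ N : ℕ, prev.m ≤ N ∧ P.Adapt prev s.z N prev.ρ prev.k s.m s.ρ s.k

/-- The stages `s 0, …, s n` form an execution of the algorithm in which the main loop has been
entered `n` times. The initial sample size is any positive integer. -/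
def IsExecution (s : ℕ → Stage p K) (n : ℕ) : Prop :=
  ((s 0).ν = P.ν₀ ∧ 1 ≤ (s 0).m ∧ (s 0).ρ = P.ρ₀ ∧ (s 0).k = 0) ∧
    ∀ j < n, ¬ P.Stopped (s j) ∧ P.Iteration (s j) (s (j + 1))

/-- The main loop is left at stage `n`, so that `J = n + 1`, and the biasing distribution that is
returned has parameter `θ`: it solves the Monte Carlo problem of the last stage with the rare event
`A` itself. -/
def Returns (s : ℕ → Stage p K) (n : ℕ) (θ : Vec d) : Prop :=
  P.IsExecution s n ∧ P.Stopped (s n) ∧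
    θ ∈ argmaxOn (P.objective (s n).ν (s n).z (s n).m P.A) P.Θ

/-- The quantile-increase condition
`γ(ν_j, ρ_j, φ) ≥ min {γ⋆, γ(ν_{j-1}, ρ_{j-1}, φ) + δ}`, for `j = 1, …, n`. -/
def QuantileIncrease (s : ℕ → Stage p K) (n : ℕ) : Prop :=
  ∀ j < n, min P.γstar (popQuantile (s j).ν (s j).ρ P.φ + P.δ) ≤
    popQuantile (s (j + 1)).ν (s (j + 1)).ρ P.φ

/-- The empirical quantile `γ(ν̂_0, ρ_0, φ)` of the original score at the initial stage. -/
noncomputable def initialQuantile (s : ℕ → Stage p K) : ℝ :=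
  empQuantile (s 0).z (s 0).m P.ρ₀ P.φ

/-- The bound `⌈(γ⋆ - γ(ν̂_0, ρ_0, φ)) / δ⌉ + 1` on the number of iterations. -/
noncomputable def Jmax (s : ℕ → Stage p K) : ℤ :=
  ⌈(P.γstar - P.initialQuantile s) / P.δ⌉ + 1

end Problem

end CrossEntropy

/-! Iteration bound: an iteration ends with the quantile and error conditions both true. If the main
loop does not stop there, the target is its second term, and `γhat - αhat` is at least the previous
`γhat + αhat + δ` (`Iteration.increase`). On the samples the scores differ by at most `αhat`, so the
initial quantile of `φ` is at most `γhat + αhat` at stage 0. The quantity `γhat - αhat` thus gains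
at least `δ` per stage and stays below `γstar` until the loop stops, which bounds the number of
stages for every realisation of the samples.

Convergence: the weighted log-densities are i.i.d. random elements of the separable Banach space of
continuous functions on the compact set `Θ`, dominated by an integrable function. The Banach-valued
strong law gives uniform convergence of the Monte Carlo objective (`uniform_strong_law`,
`AssumptionB.objective_tendsto`). Maximisers of uniformly convergent functions on a compact space
approach the maximisers of the limit (`tendsto_of_argmax`). The exceptional set of samples depends
only on the last sampling density, so earlier stages may be arbitrary. -/

namespace CrossEntropy

/-! ### Empirical quantiles -/

section Quantiles

variable {X : Type*} {z : ℕ → X} {m : ℕ}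

lemma empMean_ind_eq_zero {S : Set X} (h : ∀ i < m, z i ∉ S) : empMean z m (ind S) = 0 := by
  unfold empMean
  rw [Finset.sum_eq_zero, zero_div]
  intro i hi
  exact Set.indicator_of_notMem (h i (Finset.mem_range.1 hi)) _

lemma empMean_ind_eq_one {S : Set X} (hm : 1 ≤ m) (h : ∀ i < m, z i ∈ S) :
    empMean z m (ind S) = 1 := by
  unfold empMean
  rw [Finset.sum_congr rfl (g := fun _ => (1 : ℝ))]
  · have : (m : ℝ) ≠ 0 := by positivity
    simp [this]
  · intro i hi
    exact Set.indicator_of_mem (h i (Finset.mem_range.1 hi)) _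

lemma empMean_ind_mono {S T : Set X} (h : ∀ i < m, z i ∈ S → z i ∈ T) :
    empMean z m (ind S) ≤ empMean z m (ind T) := by
  unfold empMean
  gcongr with i hi
  unfold ind
  by_cases hS : z i ∈ S
  · rw [Set.indicator_of_mem hS, Set.indicator_of_mem (h i (Finset.mem_range.1 hi) hS)]
  · rw [Set.indicator_of_notMem hS]
    exact Set.indicator_nonneg (fun _ _ => zero_le_one) _

/-- Moving the score up by at most `α` on the samples moves the empirical quantile up by at most
`α`. -/
lemma empQuantile_le_add {ρ α : ℝ} {ψ φ : X → ℝ} (hm : 1 ≤ m) (h0 : 0 < ρ) (h1 : ρ < 1)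
    (h : ∀ i < m, φ (z i) ≤ ψ (z i) + α) :
    empQuantile z m ρ φ ≤ empQuantile z m ρ ψ + α := by
  have hne : (Finset.range m).Nonempty := Finset.nonempty_range_iff.2 (by omega)
  unfold empQuantile quantile
  refine csSup_le ?_ fun s hs => ?_
  -- No sample lies strictly below the least score, so this level is admissible because `ρ < 1`.
  · refine ⟨(Finset.range m).inf' hne fun i => φ (z i), ?_⟩
    rw [Set.mem_ofPred_eq, empMean_ind_eq_zero]
    · linarith
    · intro i hi hlt
      exact absurd (Finset.inf'_le (fun i => φ (z i)) (Finset.mem_range.2 hi)) (not_le.2 hlt)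
  · rw [← sub_le_iff_le_add]
    -- Above the largest score the empirical mass is 1, which exceeds `1 - ρ` because `0 < ρ`; this
    -- bounds the admissible levels.
    refine le_csSup ⟨(Finset.range m).sup' hne fun i => ψ (z i), fun t ht => ?_⟩ ?_
    · by_contra! hlt
      rw [Set.mem_ofPred_eq, empMean_ind_eq_one hm] at ht
      · linarith
      · intro i hi
        exact (Finset.le_sup' (fun i => ψ (z i)) (Finset.mem_range.2 hi)).trans_lt hlt
    · refine (empMean_ind_mono fun i hi hlt => ?_).trans hs
      have := h i hi
      simp only [Set.mem_ofPred_eq] at hlt ⊢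
      linarith

end Quantiles

/-! ### The bound on the number of iterations -/

namespace Problem

variable {p q d K : ℕ} (P : Problem p q d K)

lemma errBound_nonneg (z : ℕ → Vec p) (m : ℕ) (k : Fin (K + 1)) : 0 ≤ P.errBound z m k :=
  mul_nonneg P.c_nonneg
    (Real.iSup_nonneg fun i => (norm_nonneg _).trans (P.err_bound k (z i)))

lemma φ_le_score_add (z : ℕ → Vec p) {m i : ℕ} (hi : i < m) (k : Fin (K + 1)) :
    P.φ (z i) ≤ P.score k (z i) + P.errBound z m k := by
  have h1 := (le_abs_self _).trans (P.h_lipschitz (P.model (Fin.last K) (z i)) (P.model k (z i)))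
  have h2 : P.err k (z i) ≤ ⨆ i : Fin m, P.err k (z i) :=
    le_ciSup (f := fun i : Fin m => P.err k (z i)) (Set.finite_range _).bddAbove ⟨i, hi⟩
  have h3 := mul_le_mul_of_nonneg_left ((P.err_bound k (z i)).trans h2) P.c_nonneg
  simp only [φ, score, errBound]
  linarith

lemma Adapt.ok {prev : Stage p K} {z : ℕ → Vec p} {m m' : ℕ} {ρ ρ' : ℝ} {k k' : Fin (K + 1)}
    (h : P.Adapt prev z m ρ k m' ρ' k') :
    P.QuantileOK prev z m' ρ' k' ∧ P.ErrorOK prev z m' k' := by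
  induction h with
  | done hok => exact hok
  | top _ _ _ _ ih => exact ih
  | keep _ _ _ _ _ ih => exact ih
  | refine _ _ _ _ ih => exact ih

/-- The term `2 * αhat prev` in the target pays for both errors: one copy stays on the left, the
other dominates `αhat s` by the error condition. -/
lemma Iteration.increase {prev s : Stage p K} (h : P.Iteration prev s) (hs : ¬ P.Stopped s) :
    P.γhat prev + P.αhat prev + P.δ ≤ P.γhat s - P.αhat s := by
  obtain ⟨-, N, -, hA⟩ := h
  obtain ⟨hq, he⟩ := hA.ok
  have he' : P.αhat s ≤ P.αhat prev := he
  rcases min_le_iff.1 hq with h1 | h1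
  -- The first term of the minimum is exactly the exit condition.
  · exact absurd h1 hs
  · change _ ≤ P.γhat s at h1
    linarith

variable {P}

lemma IsExecution.initialQuantile_le {s : ℕ → Stage p K} {n : ℕ} (h : P.IsExecution s n) :
    P.initialQuantile s ≤ P.γhat (s 0) + P.αhat (s 0) := by
  obtain ⟨⟨-, hm, hρ, -⟩, -⟩ := h
  unfold initialQuantile γhat αhat
  rw [hρ]
  exact empQuantile_le_add hm P.ρ₀_pos P.ρ₀_lt_one fun i hi => P.φ_le_score_add _ hi _

/-- The base case uses up the `+ αhat` of stage 0 to pass from `φ` to the coarse score; each later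
step has a surplus `2 * αhat`, dropped by nonnegativity. The restriction on `j` ensures that stage
`j + 1` has not stopped. -/
lemma IsExecution.lower_bound {s : ℕ → Stage p K} {n : ℕ} (h : P.IsExecution s n) (j : ℕ)
    (hj : j + 1 < n) :
    P.initialQuantile s + (j + 1) * P.δ ≤ P.γhat (s (j + 1)) - P.αhat (s (j + 1)) := by
  induction j with
  | zero =>
    have h1 := Iteration.increase P (h.2 0 (by omega)).2 (h.2 1 hj).1
    have h2 := h.initialQuantile_le
    simp only [Nat.cast_zero, zero_add, one_mul]
    linarith
  | succ j ih =>
    have h1 := Iteration.increase P (h.2 (j + 1) (by omega)).2 (h.2 (j + 1 + 1) hj).1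
    have h2 : 0 ≤ P.αhat (s (j + 1)) := P.errBound_nonneg _ _ _
    have h3 := ih (by omega)
    push_cast
    linarith

lemma IsExecution.lt_γstar {s : ℕ → Stage p K} {n : ℕ} (h : P.IsExecution s (n + 2)) :
    P.initialQuantile s + (n + 1) * P.δ < P.γstar := by
  have h1 := h.lower_bound n (by omega)
  have h2 := not_le.1 (h.2 (n + 1) (by omega)).1
  linarith

lemma IsExecution.iterations_le {s : ℕ → Stage p K} {n : ℕ} (h : P.IsExecution s n) :
    (P.initialQuantile s < P.γstar → (n : ℤ) + 1 ≤ P.Jmax s) ∧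
      (P.γstar ≤ P.initialQuantile s → n + 1 ≤ 2) := by
  have hδ := P.δ_pos
  match n, h with
  | 0, _ =>
    refine ⟨fun hlt => ?_, fun _ => by omega⟩
    -- The ceiling is at least 1, so `Jmax` is at least 2, which covers zero or one entry into the
    -- loop.
    have := Int.ceil_pos.2 (div_pos (sub_pos.2 hlt) hδ)
    unfold Jmax
    push_cast
    omega
  | 1, _ =>
    refine ⟨fun hlt => ?_, fun _ => by omega⟩
    have := Int.ceil_pos.2 (div_pos (sub_pos.2 hlt) hδ)
    unfold Jmax
    push_cast
    omega
  | n + 2, h =>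
    have h1 := h.lt_γstar
    refine ⟨fun _ => ?_, fun hle => ?_⟩
    -- Strictness matters: the ceiling is at least `n + 2`, and `J = n + 3`.
    · have h2 : (n + 1 : ℤ) < ⌈(P.γstar - P.initialQuantile s) / P.δ⌉ := by
        rw [Int.lt_ceil, lt_div_iff₀ hδ]
        push_cast
        linarith
      unfold Jmax
      push_cast
      omega
    · have : 0 ≤ (n + 1) * P.δ := by positivity
      linarith

end Problem

/-! ### Uniform law of large numbers and stability of maximisers -/

section UniformLaw

variable {Y : Type*} [MetricSpace Y] [CompactSpace Y]

/-- Evaluation on a countable dense set is a continuous injection of a Polish space into a countable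
product of lines, hence a Borel embedding (Lusin–Souslin). Measurability can therefore be tested
pointwise. -/
lemma measurable_continuousMap {X : Type*} [MeasurableSpace X] [MeasurableSpace C(Y, ℝ)]
    [BorelSpace C(Y, ℝ)] {f : X → C(Y, ℝ)} (hf : ∀ y, Measurable fun x => f x y) :
    Measurable f := by
  obtain ⟨S, hSc, hSd⟩ := TopologicalSpace.exists_countable_dense Y
  have : Countable S := hSc.to_subtype
  let e : C(Y, ℝ) → S → ℝ := fun u y => u y
  have he : Continuous e := continuous_pi fun y => continuous_eval_const (y : Y)
  have hinj : Function.Injective e := fun u v huv =>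
    DFunLike.coe_injective (Continuous.ext_on hSd u.continuous v.continuous
      fun y hy => congrFun huv ⟨y, hy⟩)
  exact (he.measurableEmbedding hinj).measurable_comp_iff.1
    (measurable_pi_lambda _ fun y => hf y)

/-- The strong law of large numbers, uniformly over a compact set of parameters. -/
theorem uniform_strong_law {X : Type*} [MeasurableSpace X] {κ : Measure X}
    {f : X → Y → ℝ} (hf : ∀ y, Measurable fun x => f x y) (hc : ∀ᵐ x ∂κ, Continuous (f x))
    {H : X → ℝ} (hH : Integrable H κ) (hfH : ∀ x y, |f x y| ≤ H x)
    {Ω : Type*} [MeasurableSpace Ω] {Pr : Measure Ω} {Z : ℕ → Ω → X} (hZ : ∀ i, Measurable (Z i))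
    (hind : iIndepFun Z Pr) (hlaw : ∀ i, Pr.map (Z i) = κ) :
    ∀ᵐ ω ∂Pr, (∀ i, Continuous (f (Z i ω))) ∧
      TendstoUniformly (fun (m : ℕ) y => (∑ i ∈ Finset.range m, f (Z i ω) y) / m)
        (fun y => ∫ x, f x y ∂κ) atTop := by
  classical
  let _ : MeasurableSpace C(Y, ℝ) := borel _
  have : BorelSpace C(Y, ℝ) := ⟨rfl⟩
  -- A measurable null set containing every `x` with discontinuous `f x`; setting `T` to zero there
  -- makes it a measurable map into `C(Y, ℝ)`.
  let N := toMeasurable κ {x | ¬ Continuous (f x)}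
  have hN : MeasurableSet N := measurableSet_toMeasurable _ _
  have hN0 : κ N = 0 := by rw [measure_toMeasurable]; exact hc
  have hcN : ∀ x ∉ N, Continuous (f x) := fun x hx => by
    by_contra h
    exact hx (subset_toMeasurable _ _ h)
  have hmN : ∀ᵐ x ∂κ, x ∉ N := measure_eq_zero_iff_ae_notMem.1 hN0
  let T : X → C(Y, ℝ) := fun x => if h : x ∈ N then 0 else ⟨f x, hcN x h⟩
  have hTN : ∀ x ∉ N, ∀ y, T x y = f x y := fun x hx y => by simp [T, hx]
  have hT : Measurable T := measurable_continuousMap fun y => by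
    have : (fun x => T x y) = Nᶜ.indicator fun x => f x y := by
      ext x
      by_cases h : x ∈ N <;> simp [T, h]
    rw [this]
    exact (hf y).indicator hN.compl
  have hTint : Integrable T κ := by
    refine ⟨hT.aestronglyMeasurable,
      ContinuousMap.hasFiniteIntegral_of_bound T H hH.hasFiniteIntegral ?_⟩
    filter_upwards [hmN] with x hx y
    rw [hTN x hx y]
    exact hfH x y
  -- Evaluation at `y` is continuous and linear, so it commutes with the Bochner integral.
  have hlim : ∀ y, (∫ x, T x ∂κ) y = ∫ x, f x y ∂κ := fun y => by
    rw [ContinuousMap.integral_apply hTint]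
    exact integral_congr_ae (hmN.mono fun x hx => hTN x hx y)
  have hid : ∀ i, IdentDistrib (Z i) (Z 0) Pr Pr := fun i =>
    ⟨(hZ i).aemeasurable, (hZ 0).aemeasurable, by rw [hlaw, hlaw]⟩
  have hslln := strong_law_ae (μ := Pr) (fun i => T ∘ Z i)
    (by
      rw [← hlaw 0] at hTint
      exact hTint.comp_measurable (hZ 0))
    (fun i j hij => (hind.indepFun hij).comp hT hT)
    (fun i => (hid i).comp hT)
  have hZN : ∀ᵐ ω ∂Pr, ∀ i, Z i ω ∉ N := ae_all_iff.2 fun i => by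
    rw [← hlaw i] at hmN
    exact ae_of_ae_map (hZ i).aemeasurable hmN
  filter_upwards [hslln, hZN] with ω hω hωN
  refine ⟨fun i => hcN _ (hωN i), ?_⟩
  have hE : (∫ ω, (T ∘ Z 0) ω ∂Pr) = ∫ x, T x ∂κ := by
    rw [← hlaw 0, integral_map (hZ 0).aemeasurable hT.aestronglyMeasurable]
    rfl
  rw [hE, ContinuousMap.tendsto_iff_tendstoUniformly] at hω
  convert hω using 2 with m
  · ext y
    simp [hTN _ (hωN _), div_eq_inv_mul]
  · exact (hlim _).symm

end UniformLaw

/-- Maximisers of uniformly convergent functions on a compact space approach the maximisers of the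
limit. -/
lemma tendsto_of_argmax {Y : Type*} [TopologicalSpace Y] [CompactSpace Y] {F D : Y → ℝ}
    (hF : Continuous F) (hD : Continuous D) (hD0 : ∀ y, 0 ≤ D y)
    (hmax : ∀ y, (∀ y', F y' ≤ F y) → D y = 0) {G : ℕ → Y → ℝ}
    (hG : TendstoUniformly G F atTop) {m : ℕ → ℕ} (hm : Tendsto m atTop atTop) {θ : ℕ → Y}
    (hθ : ∀ l y, G (m l) y ≤ G (m l) (θ l)) :
    Tendsto (fun l => D (θ l)) atTop (𝓝 0) := by
  rw [Metric.tendsto_atTop']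
  intro ε hε
  have : Nonempty Y := ⟨θ 0⟩
  obtain ⟨y₀, -, hy₀⟩ := isCompact_univ.exists_isMaxOn Set.univ_nonempty hF.continuousOn
  have hy₀' : ∀ y, F y ≤ F y₀ := fun y => hy₀ (Set.mem_univ y)
  -- On the compact set `ε ≤ D` the maximum of `F` is attained and cannot be global, since `D`
  -- vanishes at global maximisers.
  have hgap : ∃ η > 0, ∀ y, ε ≤ D y → F y + η ≤ F y₀ := by
    rcases Set.eq_empty_or_nonempty {y | ε ≤ D y} with he | hne
    · exact ⟨1, one_pos, fun y hy => absurd hy (Set.eq_empty_iff_forall_notMem.1 he y)⟩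
    · obtain ⟨y₁, hy₁, hy₁m⟩ := (isClosed_le continuous_const hD).isCompact.exists_isMaxOn hne
        hF.continuousOn
      have hlt : F y₁ < F y₀ := lt_of_le_of_ne (hy₀' y₁) fun heq => by
        have h0 := hmax y₁ (by rwa [heq])
        have : ε ≤ D y₁ := hy₁
        linarith
      refine ⟨F y₀ - F y₁, sub_pos.2 hlt, fun y hy => ?_⟩
      have : F y ≤ F y₁ := hy₁m hy
      linarith
  obtain ⟨η, hη, hgap⟩ := hgap
  obtain ⟨L, hL⟩ := eventually_atTop.1
    -- An error below `η / 2` at each of `y₀` and `θ l` cannot bridge the gap `η`.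
    (hm.eventually (Metric.tendstoUniformly_iff.1 hG (η / 2) (half_pos hη)))
  refine ⟨L, fun l hl => ?_⟩
  rw [Real.dist_eq, sub_zero, abs_of_nonneg (hD0 _)]
  by_contra! hge
  have h1 := hgap _ hge
  have h2 := abs_lt.1 ((Real.dist_eq _ _).symm.trans_lt (hL l hl.le y₀))
  have h3 := abs_lt.1 ((Real.dist_eq _ _).symm.trans_lt (hL l hl.le (θ l)))
  have h4 := hθ l y₀
  linarith [h2.2, h3.1]

/-! ### Change of density -/

section Densities

variable {p : ℕ} {f g : Vec p → ℝ}

lemma measurable_ofReal_div (hf : IsDensity f) (hg : IsDensity g) :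
    Measurable fun x => ENNReal.ofReal (f x / g x) :=
  (hf.measurable.div hg.measurable).ennreal_ofReal

/-- Where `f` vanishes both densities are zero, so the value of `g` there is irrelevant. -/
lemma law_eq_withDensity_div (hf : IsDensity f) (hg : IsDensity g) (hfg : ∀ x, 0 < f x → 0 < g x) :
    law f = (law g).withDensity fun x => ENNReal.ofReal (f x / g x) := by
  unfold law
  rw [← withDensity_mul _ hg.measurable.ennreal_ofReal
    (measurable_ofReal_div hf hg)]
  congr 1
  ext x
  rw [Pi.mul_apply, ← ENNReal.ofReal_mul (hg.nonneg x)]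
  rcases (hf.nonneg x).eq_or_lt with h | h
  · rw [← h, zero_div, mul_zero]
  · rw [mul_div_cancel₀ _ (hfg x h).ne']

lemma integrable_law_iff (hf : IsDensity f) (hg : IsDensity g) (hfg : ∀ x, 0 < f x → 0 < g x)
    {u : Vec p → ℝ} :
    Integrable u (law f) ↔ Integrable (fun x => f x / g x * u x) (law g) := by
  rw [law_eq_withDensity_div hf hg hfg, integrable_withDensity_iff_integrable_smul'
    (measurable_ofReal_div hf hg) (by simp)]
  simp [ENNReal.toReal_ofReal, div_nonneg (hf.nonneg _) (hg.nonneg _)]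

lemma integral_law (hf : IsDensity f) (hg : IsDensity g) (hfg : ∀ x, 0 < f x → 0 < g x)
    (u : Vec p → ℝ) :
    ∫ x, u x ∂(law f) = ∫ x, f x / g x * u x ∂(law g) := by
  rw [law_eq_withDensity_div hf hg hfg, integral_withDensity_eq_integral_toReal_smul
    (measurable_ofReal_div hf hg) (by simp)]
  simp [ENNReal.toReal_ofReal, div_nonneg (hf.nonneg _) (hg.nonneg _)]

/-- The restriction to `0 < f x` is needed because `law g` may charge the zero set of `f`. -/
lemma ae_law_of_ae_law (hf : IsDensity f) (hg : IsDensity g) (hfg : ∀ x, 0 < f x → 0 < g x)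
    {r : Vec p → Prop} (h : ∀ᵐ x ∂(law f), r x) : ∀ᵐ x ∂(law g), 0 < f x → r x := by
  rw [law_eq_withDensity_div hf hg hfg,
    ae_withDensity_iff (measurable_ofReal_div hf hg)] at h
  filter_upwards [h] with x hx h0
  exact hx (by simpa using div_pos h0 (hfg x h0))

end Densities

/-! ### Convergence of the cross-entropy objective -/

namespace Problem

variable {p q d K : ℕ} (P : Problem p q d K)

lemma measurableSet_A : MeasurableSet P.A := by
  have hh : Continuous P.h := by
    refine (LipschitzWith.of_dist_le_mul (K := ⟨P.c, P.c_nonneg⟩) fun u v => ?_).continuous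
    rw [Real.dist_eq, dist_eq_norm]
    exact P.h_lipschitz u v
  exact measurableSet_le measurable_const
    (hh.measurable.comp (P.model_measurable (Fin.last K)))

lemma abs_ind_mul_le {X : Type*} (S : Set X) (x : X) (a : ℝ) : |ind S x * a| ≤ |a| := by
  unfold ind
  by_cases h : x ∈ S <;> simp [h]

variable {P}

lemma AssumptionB.continuous_expectation (hB : P.AssumptionB) :
    ContinuousOn (fun θ => ∫ x, ind P.A x * Real.log (P.ν θ x) ∂(law P.μ)) P.Θ := by
  obtain ⟨H, hH, hle⟩ := hB.dominated
  refine continuousOn_of_dominated (bound := H) (fun θ hθ => ?_) (fun θ hθ => ?_) hH ?_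
  · exact ((measurable_const.indicator P.measurableSet_A).mul
      (P.ν_density θ hθ).measurable.log).aestronglyMeasurable
  · exact Eventually.of_forall fun x => (abs_ind_mul_le _ _ _).trans (hle θ hθ x).2
  · filter_upwards [hB.continuous] with x hx
    exact continuousOn_const.mul hx

lemma AssumptionB.optimal_nonempty (hB : P.AssumptionB) : P.optimal.Nonempty := by
  obtain ⟨θ, hθ, hmax⟩ := hB.compact.exists_isMaxOn P.Θ_nonempty hB.continuous_expectation
  exact ⟨θ, hθ, fun y hy => hmax hy⟩

lemma AssumptionB.proposal (hB : P.AssumptionB) {g : Vec p → ℝ}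
    (hg : g = P.ν₀ ∨ ∃ θ ∈ P.Θ, g = P.ν θ) : IsDensity g ∧ ∀ x, 0 < P.μ x → 0 < g x := by
  obtain ⟨H, -, hle⟩ := hB.dominated
  rcases hg with rfl | ⟨θ, hθ, rfl⟩
  · exact ⟨P.ν₀_density, P.ν₀_support⟩
  · exact ⟨P.ν_density θ hθ, fun x _ => (hle θ hθ x).1⟩

/-- Uniform convergence of the Monte Carlo objective to the cross-entropy objective. -/
lemma AssumptionB.objective_tendsto (hB : P.AssumptionB) {g : Vec p → ℝ}
    (hg : g = P.ν₀ ∨ ∃ θ ∈ P.Θ, g = P.ν θ) {Ω : Type*} [MeasurableSpace Ω] {Pr : Measure Ω}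
    {Z : ℕ → Ω → Vec p} (hZ : ∀ i, Measurable (Z i)) (hind : iIndepFun Z Pr)
    (hlaw : ∀ i, Pr.map (Z i) = law g) :
    ∀ᵐ ω ∂Pr, (∀ m, Continuous fun θ : P.Θ => P.objective g (fun i => Z i ω) m P.A θ) ∧
      TendstoUniformly (fun m (θ : P.Θ) => P.objective g (fun i => Z i ω) m P.A θ)
        (fun θ => ∫ x, ind P.A x * Real.log (P.ν θ x) ∂(law P.μ)) atTop := by
  obtain ⟨hgd, hsupp⟩ := hB.proposal hg
  obtain ⟨H, hH, hle⟩ := hB.dominated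
  have : CompactSpace P.Θ := isCompact_iff_compactSpace.1 hB.compact
  have hw : ∀ x, 0 ≤ P.μ x / g x := fun x => div_nonneg (P.μ_density.nonneg x) (hgd.nonneg x)
  have hconv := uniform_strong_law (κ := law g)
    (f := fun x (θ : P.Θ) => ind P.A x * (P.μ x / g x) * Real.log (P.ν θ x))
    (fun θ => ((measurable_const.indicator P.measurableSet_A).mul
      (P.μ_density.measurable.div hgd.measurable)).mul (P.ν_density θ θ.2).measurable.log)
    (by
      filter_upwards [ae_law_of_ae_law P.μ_density hgd hsupp hB.continuous] with x hx
      -- Continuity of the log-density is known only where `μ` is positive; elsewhere the weight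
      -- makes the integrand identically zero in `θ`.
      rcases (P.μ_density.nonneg x).eq_or_lt with h | h
      · simpa only [← h, zero_div, mul_zero, zero_mul] using continuous_const
      · exact continuous_const.mul (continuousOn_iff_continuous_domRestrict.1 (hx h)))
    ((integrable_law_iff P.μ_density hgd hsupp).1 hH)
    (fun x θ => by
      rw [mul_assoc]
      refine (abs_ind_mul_le _ _ _).trans ?_
      rw [abs_mul, abs_of_nonneg (hw x)]
      exact mul_le_mul_of_nonneg_left (hle θ θ.2 x).2 (hw x)) hZ hind hlaw
  filter_upwards [hconv] with ω ⟨hcont, hunif⟩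
  refine ⟨fun m => ?_, ?_⟩
  · unfold objective empMean
    exact (continuous_finsetSum _ fun i _ => hcont i).div_const _
  · have heq : (fun θ : P.Θ => ∫ x, ind P.A x * Real.log (P.ν θ x) ∂(law P.μ)) =
        fun θ : P.Θ => ∫ x, ind P.A x * (P.μ x / g x) * Real.log (P.ν θ x) ∂(law g) := by
      ext θ
      rw [integral_law P.μ_density hgd hsupp]
      congr 1
      ext x
      ring
    rw [heq]
    exact hunif

lemma AssumptionB.continuousOn_density (hB : P.AssumptionB) :
    ∀ᵐ x ∂(law P.μ), ContinuousOn (fun θ => P.ν θ x) P.Θ := by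
  obtain ⟨H, -, hle⟩ := hB.dominated
  filter_upwards [hB.continuous] with x hx
  exact hx.rexp.congr fun θ hθ => (Real.exp_log (hle θ hθ x).1).symm

end Problem

end CrossEntropy

/-! ### The proposition -/

theorem mainTheorem3 {p q d K : ℕ} (P : CrossEntropy.Problem p q d K) (hB : P.AssumptionB) :
    -- every execution that satisfies the quantile-increase condition has `J ≤ Jmax`
    (∀ (s : ℕ → CrossEntropy.Stage p K) (n : ℕ),
      P.IsExecution s n → P.QuantileIncrease s n →
        (P.initialQuantile s < P.γstar → (n : ℤ) + 1 ≤ P.Jmax s) ∧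
        (P.γstar ≤ P.initialQuantile s → n + 1 ≤ 2)) ∧
    -- almost sure convergence of the output as the sample size tends to infinity
    P.optimal.Nonempty ∧
    ∀ (g : CrossEntropy.Vec p → ℝ), (g = P.ν₀ ∨ ∃ θ ∈ P.Θ, g = P.ν θ) →
      ∀ {Ω : Type*} [MeasurableSpace Ω] (Pr : MeasureTheory.Measure Ω)
        [MeasureTheory.IsProbabilityMeasure Pr] (Z : ℕ → Ω → CrossEntropy.Vec p),
        (∀ i, Measurable (Z i)) → ProbabilityTheory.iIndepFun Z Pr →
        (∀ i, Pr.map (Z i) = CrossEntropy.law g) →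
        ∀ᵐ ω ∂Pr,
          (∀ m : ℕ, (CrossEntropy.argmaxOn
            (P.objective g (fun i => Z i ω) m P.A) P.Θ).Nonempty) ∧
          ∀ (s : ℕ → ℕ → CrossEntropy.Stage p K) (n : ℕ → ℕ) (θ : ℕ → CrossEntropy.Vec d),
            (∀ l, P.Returns (s l) (n l) (θ l) ∧ P.QuantileIncrease (s l) (n l) ∧
              (s l (n l)).ν = g ∧ (s l (n l)).z = fun i => Z i ω) →
            Filter.Tendsto (fun l => (s l (n l)).m) Filter.atTop Filter.atTop →
            Filter.Tendsto (fun l => Metric.infDist (θ l) P.optimal) Filter.atTop (nhds 0) ∧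
            ∀ᵐ x ∂(CrossEntropy.law P.μ),
              Filter.Tendsto
                (fun l => Metric.infDist (P.ν (θ l) x) ((fun t => P.ν t x) '' P.optimal))
                Filter.atTop (nhds 0) := by
  refine ⟨fun s n hs _ => hs.iterations_le, hB.optimal_nonempty, ?_⟩
  intro g hg Ω _ Pr _ Z hZ hind hlaw
  have : CompactSpace P.Θ := isCompact_iff_compactSpace.1 hB.compact
  have : Nonempty P.Θ := P.Θ_nonempty.to_subtype
  have hF := continuousOn_iff_continuous_domRestrict.1 hB.continuous_expectation
  filter_upwards [hB.objective_tendsto hg hZ hind hlaw] with ω ⟨hcont, hunif⟩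
  refine ⟨fun m => ?_, fun s n θ hs hm => ?_⟩
  · obtain ⟨θ, -, hθ⟩ := isCompact_univ.exists_isMaxOn Set.univ_nonempty (hcont m).continuousOn
    exact ⟨θ, θ.2, fun y hy => hθ (Set.mem_univ ⟨y, hy⟩)⟩
  · have hθ : ∀ l, θ l ∈ CrossEntropy.argmaxOn
        (P.objective g (fun i => Z i ω) (s l (n l)).m P.A) P.Θ := fun l => by
      obtain ⟨⟨-, -, h⟩, -, hν, hz⟩ := hs l
      rwa [hν, hz] at h
    -- One statement gives both limits: `D` is the distance to `optimal`, or, for fixed `x`, the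
    -- distance from the density value to the optimal density values.
    have key : ∀ D : CrossEntropy.Vec d → ℝ, ContinuousOn D P.Θ → (∀ y, 0 ≤ D y) →
        (∀ y ∈ P.optimal, D y = 0) → Tendsto (fun l => D (θ l)) atTop (nhds 0) :=
      fun D hD hD0 hDopt => CrossEntropy.tendsto_of_argmax (Y := P.Θ) hF
        (continuousOn_iff_continuous_domRestrict.1 hD) (fun y => hD0 y)
        (fun y hy => hDopt y ⟨y.2, fun y' hy' => hy ⟨y', hy'⟩⟩) hunif hm
        (θ := fun l => ⟨θ l, (hθ l).1⟩) fun l y => (hθ l).2 y y.2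
    refine ⟨key _ (Metric.continuous_infDist_pt _).continuousOn
      (fun _ => Metric.infDist_nonneg) fun y hy => Metric.infDist_zero_of_mem hy, ?_⟩
    filter_upwards [hB.continuousOn_density] with x hx
    exact key (fun t => Metric.infDist (P.ν t x) ((fun t => P.ν t x) '' P.optimal))
      ((Metric.continuous_infDist_pt _).comp_continuousOn hx)
      (fun _ => Metric.infDist_nonneg)
      fun y hy => Metric.infDist_zero_of_mem (Set.mem_image_of_mem _ hy)
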